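/- Let $\mathcal X$ be a finite set and $\mathcal Y$ a finite or countably infinite set; $\log$ is the natural logarithm. For a probability distribution $P$ on $\mathcal X\times\mathcal Y$ with marginal $P_Y$ put $H(P)=\sum_{x,y}P(x,y)\log\frac{P_Y(y)}{P(x,y)}$ (the conditional entropy $H(X|Y)$; terms with $P(x,y)=0$ are $0$) and, for $a\in(0,1)$, $H_a(P)=\frac{a}{1-a}\log\sum_y\bigl[\sum_xP(x,y)^a\bigr]^{1/a}$ (the conditional Rényi entropy). A guessing strategy $G$ for a random variable with values in a finite set $\mathcal A$, $|\mathcal A|=K$, given side information with values in a countable set $\mathcal B$, consists, for each $y\in\mathcal B$, of a bijection $\sigma_y:\mathcal A\to\{1,\dots,K\}$ (the order of the guesses) and of numbers $\pi_y(1),\dots,\pi_y(K)\in[0,1]$, where $\pi_y(i)$ is the probability of giving up just before the $i$-th guess. With $\lambda_y(i)=\prod_{j\le i}(1-\pi_y(j))$, its error probability and its cost under a law $P$ on $\mathcal A\times\mathcal B$ are $$p_e(G|P)=1-\sum_{x,y}\lambda_y(\sigma_y(x))P(x,y),\qquad \bar C_\rho(G|P)=\sum_{x,y}\lambda_y(\sigma_y(x))P(x,y)\,\sigma_y(x)^\rho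 .$$ A source $S$ is a sequence of laws $S_n$ on $\mathcal X^n\times\mathcal Y^n$, $n\ge1$. For $\rho>0$ and $\varepsilon\in[0,1)$, a real number $E$ is $\varepsilon$-achievable if there are strategies $G_n$ for $\mathcal X^n$ given $\mathcal Y^n$ with $\limsup_n p_e(G_n|S_n)\le\varepsilon$ and $\limsup_n\frac1n\log\bar C_\rho(G_n|S_n)\le E$; the optimal guessing exponent $E(\rho,\varepsilon|S)$ is the infimum of the $\varepsilon$-achievable values. Let $P_1,\dots,P_m$ be probability distributions on $\mathcal X\times\mathcal Y$ with $H(P_1)>H(P_2)>\dots>H(P_m)$, let $\alpha_1,\dots,\alpha_m>0$ with $\sum_i\alpha_i=1$, and let $S$ be the mixture of the i.i.d. sources, $S_n(x^n,y^n)=\sum_{i=1}^m\alpha_i\prod_{t=1}^nP_i(x_t,y_t)$ for all $n\ge1$. Put $A_i=\sum_{j<i}\alpha_j$ for $1\le i\le m+1$ (so that $A_{m+1}=1$). Then for every $\rho>0$ and every $\varepsilon\in[0,1)$ there is exactly one $i\in\{1,\dots,m\}$ with $\varepsilon\in[A_i,A_{i+1})$, and for this $i$ $$E(\rho,\varepsilon|S)=\rho\,H(P_i).$$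 In particular, for an i.i.d. source with single-letter law $P$ and $\varepsilon=0$ (vanishing error probability), $E(\rho,0|S)=\rho\,H(P)$ for every $\rho>0$. This is in general not the exponent $\rho H_{1/(1+\rho)}(P)$ given by the conditional Rényi entropy (Arikan's exponent for guessing without error): if $|\mathcal X|\ge2$ and $\mathcal Y\neq\emptyset$, then for every $\rho>0$ there is an i.i.d. source $S$, with single-letter law $P$ on $\mathcal X\times\mathcal Y$, for which $E(\rho,0|S)<\rho H_{1/(1+\rho)}(P)$. -/

import Mathlib

open Filter

noncomputable section

namespace Guessing

/-- `P_{XY}(x, y)` as a real number. -/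
def prob {X Y : Type*} (P : PMF (X × Y)) (x : X) (y : Y) : ℝ := (P (x, y)).toReal

/-- The marginal probability `P_Y(y)`. -/
def margY {X Y : Type*} [Fintype X] (P : PMF (X × Y)) (y : Y) : ℝ := ∑ x, prob P x y

/-- The conditional entropy `H(X|Y) = ∑ P_{XY}(x,y) log (1 / P_{X|Y}(x|y))` (in nats), where
`P_{X|Y}(x|y) = P_{XY}(x,y) / P_Y(y)`. Pairs of probability zero contribute zero; for finite `X`
the series of nonnegative terms always converges, its sum being at most `log |X|`. -/
def condEntropy {X Y : Type*} [Fintype X] (P : PMF (X × Y)) : ℝ :=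
  ∑' y, ∑ x, prob P x y * Real.log (1 / (prob P x y / margY P y))

/-- The (Arimoto) conditional Rényi entropy of order `a`, for `0 < a < 1`. -/
def condRenyiEntropy {X Y : Type*} [Fintype X] (a : ℝ) (P : PMF (X × Y)) : ℝ :=
  a / (1 - a) * Real.log (∑' y, (∑ x, prob P x y ^ a) ^ (1 / a))

/-- A guessing strategy for `X` given `Y`: for every `y` an order `σ y` in which the elements of
`X` are guessed (`σ y x = i` means that `x` is the guess at the step `i + 1`), and for every step
the probability `quit y i` of giving up just before that guess. -/
structure Strategy (X Y : Type*) [Fintype X] where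
  σ : Y → X ≃ Fin (Fintype.card X)
  quit : Y → Fin (Fintype.card X) → ℝ
  quit_nonneg : ∀ y i, 0 ≤ quit y i
  quit_le_one : ∀ y i, quit y i ≤ 1

variable {X Y : Type*} [Fintype X]

/-- `λ_y(i)`: the probability of not giving up at any of the steps up to and including `i`. -/
def Strategy.survive (G : Strategy X Y) (y : Y) (i : Fin (Fintype.card X)) : ℝ :=
  ∏ j ∈ Finset.Iic i, (1 - G.quit y j)

/-- The error probability `p_e(G|X,Y)`: the probability that the guesser gives up before the value
of `X` has been guessed. -/
def Strategy.errorProb (G : Strategy X Y) (P : PMF (X × Y)) : ℝ :=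
  1 - ∑' y, ∑ x, G.survive y (G.σ y x) * prob P x y

/-- The expected cost of guessing: a cost `i ^ ρ` is incurred if the value of `X` is
correctly guessed at the step `i = 1, 2, …`, and no cost is counted if the guesser gives up. -/
def Strategy.cost (G : Strategy X Y) (ρ : ℝ) (P : PMF (X × Y)) : ℝ :=
  ∑' y, ∑ x, G.survive y (G.σ y x) * prob P x y * (((G.σ y x : ℕ) : ℝ) + 1) ^ ρ

/-- A general source: for every `n` an arbitrary joint law of `(X^n, Y^n)` on `X^n × Y^n`
(no consistency between different `n`; the value at `n = 0` never matters). -/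
abbrev Source (X Y : Type*) := (n : ℕ) → PMF ((Fin n → X) × (Fin n → Y))

/-- `E` is `ε`-achievable (`0 ≤ ε < 1`): some sequence of strategies has asymptotic error
probability at most `ε` and asymptotic exponent of the cost at most `E`. Superior limits are taken
in the extended reals. Since the cost is at least `1 - p_e`, the first condition
makes the cost positive for all large `n`, so that the value of `Real.log` at `0` is irrelevant. -/
def IsAchievable (S : Source X Y) (ρ ε E : ℝ) : Prop :=
  ∃ G : (n : ℕ) → Strategy (Fin n → X) (Fin n → Y),
    limsup (fun n => (((G n).errorProb (S n) : ℝ) : EReal)) atTop ≤ (ε : EReal) ∧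
    limsup (fun n : ℕ => ((1 / (n : ℝ) * Real.log ((G n).cost ρ (S n)) : ℝ) : EReal)) atTop
      ≤ (E : EReal)

/-- The optimal guessing exponent: the infimum, in the extended reals, of the `ε`-achievable
values. -/
def guessExponent (S : Source X Y) (ρ ε : ℝ) : EReal :=
  ⨅ (E : ℝ) (_ : IsAchievable S ρ ε E), (E : EReal)

/-- `S` is the i.i.d. source with single-letter law `P`. -/
def IsIID {X Y : Type*} (S : Source X Y) (P : PMF (X × Y)) : Prop :=
  ∀ n : ℕ, 1 ≤ n → ∀ (x : Fin n → X) (y : Fin n → Y),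
    prob (S n) x y = ∏ t, prob P (x t) (y t)

/-- `S` is a mixture, with weights `α`, of the i.i.d. sources with laws `P 0, …, P (m - 1)`. -/
structure IsMixture {X Y : Type*} {m : ℕ} (S : Source X Y) (P : Fin m → PMF (X × Y))
    (α : Fin m → ℝ) : Prop where
  sum_eq_one : ∑ i, α i = 1
  pos : ∀ i, 0 < α i
  law : ∀ n : ℕ, 1 ≤ n → ∀ (x : Fin n → X) (y : Fin n → Y),
    prob (S n) x y = ∑ i, α i * ∏ t, prob (P i) (x t) (y t)

end Guessing

end

/-!
Everything rests on the weak law of large numbers for the conditional information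
`-log P(x | y)` (`tendsto_atypProb`): for a finite alphabet `X` it has a finite second moment,
since `q log² q` is bounded on `[0, 1]`, so Chebyshev's inequality applies. Hence under the
component `P j` of the mixture a pair of blocks of length `n` has conditional probability
`exp (-n (H(P j) ± δ))`, up to an event of vanishing probability.

Achievability (`IsMixture.exists_strategy`). Given `y`, guess the blocks `x` for which the sum of
the component conditional probabilities is at least `exp (-n (H(P i) + δ))`, then give up. There
are at most `m exp (n (H(P i) + δ))` of them, because each conditional law has total mass at most
`1`; this bounds the cost. Every component `j ≥ i` has entropy at most `H(P i)`, so it contributes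
a vanishing error, and the components `j < i` contribute at most their weight, which is at most
`ε`.

Converse (`IsMixture.le_cost`). If the asymptotic error is at most `ε < α 0 + … + α i`, then with
probability bounded below the source follows a component `j ≤ i`, of entropy at least `H(P i)`, and
the guess is correct. On its typical blocks such a component has conditional probabilities at most
`exp (-n (H(P i) - δ))`, so the first `M = exp (n (H(P i) - 2 δ))` guesses succeed with probability
at most `exp (-n δ)` (`expect_survive_le`). The remaining correct guesses cost at least `M ^ ρ`
each.

A memoryless source is a mixture with one component. Its exponent `ρ H` is smaller than that of the
Rényi entropy by Jensen's inequality, strictly when the letter law is not uniform on its support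
(`binary_entropy_lt_renyi`).
-/

noncomputable section

namespace Guessing

open scoped Topology

/-! ### Expectations under a law on a product -/

/-- The expectation `∑ F(x, y) Q(x, y)`, summed in the order in which the error probability and the
cost of a strategy are defined. -/
def expect {A B : Type*} [Fintype A] (Q : PMF (A × B)) (F : A → B → ℝ) : ℝ :=
  ∑' y, ∑ x, F x y * prob Q x y

section expect

variable {A B : Type*} [Fintype A]

lemma prob_nonneg {A B : Type*} (Q : PMF (A × B)) (x : A) (y : B) : 0 ≤ prob Q x y :=
  ENNReal.toReal_nonneg

lemma summable_toReal_pmf {Z : Type*} (Q : PMF Z) : Summable fun z => (Q z).toReal :=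
  ENNReal.summable_toReal Q.tsum_coe_ne_top

lemma tsum_toReal_pmf {Z : Type*} (Q : PMF Z) : ∑' z, (Q z).toReal = 1 := by
  rw [← ENNReal.tsum_toReal_eq Q.apply_ne_top, Q.tsum_coe, ENNReal.toReal_one]

lemma margY_nonneg (Q : PMF (A × B)) (y : B) : 0 ≤ margY Q y :=
  Finset.sum_nonneg fun _ _ => prob_nonneg _ _ _

lemma prob_le_margY (Q : PMF (A × B)) (x : A) (y : B) : prob Q x y ≤ margY Q y :=
  Finset.single_le_sum (f := fun x => prob Q x y) (fun _ _ => prob_nonneg _ _ _)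
    (Finset.mem_univ x)

lemma summable_sum_of_summable_prod {f : A × B → ℝ} (hf : Summable f) :
    Summable fun y => ∑ x, f (x, y) := by
  have h := ((Equiv.prodComm B A).summable_iff.2 hf).prod
  simpa [tsum_fintype] using h

lemma tsum_sum_eq_tsum_prod {f : A × B → ℝ} (hf : Summable f) :
    ∑' y, ∑ x, f (x, y) = ∑' z, f z := by
  have h := ((Equiv.prodComm B A).summable_iff.2 hf).tsum_prod
  rw [(Equiv.prodComm B A).tsum_eq f |>.symm]
  simpa [tsum_fintype] using h.symm

lemma summable_margY (Q : PMF (A × B)) : Summable (margY Q) :=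
  summable_sum_of_summable_prod (f := fun z => (Q z).toReal) (summable_toReal_pmf Q)

lemma tsum_margY (Q : PMF (A × B)) : ∑' y, margY Q y = 1 := by
  rw [← tsum_toReal_pmf Q, ← tsum_sum_eq_tsum_prod (summable_toReal_pmf Q)]
  rfl

lemma summable_mul_prob {A B : Type*} (Q : PMF (A × B)) {F : A → B → ℝ} {C : ℝ}
    (hF : ∀ x y, |F x y| ≤ C) :
    Summable fun z : A × B => F z.1 z.2 * prob Q z.1 z.2 := by
  refine Summable.of_norm_bounded ((summable_toReal_pmf Q).mul_left C) fun z => ?_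
  rw [Real.norm_eq_abs, abs_mul, abs_of_nonneg (prob_nonneg Q z.1 z.2)]
  exact mul_le_mul_of_nonneg_right (hF _ _) (prob_nonneg _ _ _)

lemma summable_expect (Q : PMF (A × B)) {F : A → B → ℝ} {C : ℝ} (hF : ∀ x y, |F x y| ≤ C) :
    Summable fun y => ∑ x, F x y * prob Q x y :=
  summable_sum_of_summable_prod (f := fun z => F z.1 z.2 * prob Q z.1 z.2) (summable_mul_prob Q hF)

lemma expect_eq_tsum_prod (Q : PMF (A × B)) {F : A → B → ℝ} {C : ℝ} (hF : ∀ x y, |F x y| ≤ C) :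
    expect Q F = ∑' z : A × B, F z.1 z.2 * prob Q z.1 z.2 :=
  tsum_sum_eq_tsum_prod (f := fun z => F z.1 z.2 * prob Q z.1 z.2) (summable_mul_prob Q hF)

lemma expect_const (Q : PMF (A × B)) (c : ℝ) : expect Q (fun _ _ => c) = c := by
  rw [expect_eq_tsum_prod Q (C := |c|) fun _ _ => le_rfl]
  simp only [tsum_mul_left, prob, Prod.mk.eta, tsum_toReal_pmf, mul_one]

/-- Monotonicity of the expectation; the comparison is only needed where `Q` has mass. -/
lemma expect_mono (Q : PMF (A × B)) {F F' : A → B → ℝ} {C C' : ℝ} (hF : ∀ x y, |F x y| ≤ C)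
    (hF' : ∀ x y, |F' x y| ≤ C') (h : ∀ x y, prob Q x y ≠ 0 → F x y ≤ F' x y) :
    expect Q F ≤ expect Q F' := by
  refine (summable_expect Q hF).tsum_le_tsum (fun y => Finset.sum_le_sum fun x _ => ?_)
    (summable_expect Q hF')
  by_cases h0 : prob Q x y = 0
  · simp [h0]
  · exact mul_le_mul_of_nonneg_right (h x y h0) (prob_nonneg _ _ _)

lemma expect_nonneg (Q : PMF (A × B)) {F : A → B → ℝ} (h : ∀ x y, 0 ≤ F x y) : 0 ≤ expect Q F :=
  tsum_nonneg fun _ => Finset.sum_nonneg fun _ _ => mul_nonneg (h _ _) (prob_nonneg _ _ _)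

lemma expect_add (Q : PMF (A × B)) {F F' : A → B → ℝ} {C C' : ℝ} (hF : ∀ x y, |F x y| ≤ C)
    (hF' : ∀ x y, |F' x y| ≤ C') :
    expect Q (fun x y => F x y + F' x y) = expect Q F + expect Q F' := by
  rw [expect, expect, expect, ← (summable_expect Q hF).tsum_add (summable_expect Q hF')]
  simp_rw [add_mul, Finset.sum_add_distrib]

lemma expect_const_mul (Q : PMF (A × B)) (c : ℝ) (F : A → B → ℝ) :
    expect Q (fun x y => c * F x y) = c * expect Q F := by
  rw [expect, expect, ← tsum_mul_left]
  simp_rw [Finset.mul_sum, mul_assoc]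

lemma expect_mixture {m : ℕ} {Q : PMF (A × B)} {Q' : Fin m → PMF (A × B)} {α : Fin m → ℝ}
    (hQ : ∀ x y, prob Q x y = ∑ i, α i * prob (Q' i) x y) {F : A → B → ℝ} {C : ℝ}
    (hF : ∀ x y, |F x y| ≤ C) : expect Q F = ∑ i, α i * expect (Q' i) F := by
  simp_rw [expect, ← tsum_mul_left]
  rw [← Summable.tsum_finsetSum fun i _ => (summable_expect (Q' i) hF).mul_left (α i)]
  congr 1 with y
  simp_rw [hQ, Finset.mul_sum]
  rw [Finset.sum_comm]
  refine Finset.sum_congr rfl fun _ _ => Finset.sum_congr rfl fun _ _ => by ring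

end expect

/-! ### Memoryless sources -/

open MeasureTheory in
/-- The law of `n` independent letters with common law `p`. -/
def iidPMF {Z : Type*} [Countable Z] (p : PMF Z) (n : ℕ) : PMF (Fin n → Z) :=
  letI : MeasurableSpace Z := ⊤
  (Measure.pi fun _ : Fin n => p.toMeasure).toPMF

open MeasureTheory in
lemma iidPMF_apply {Z : Type*} [Countable Z] (p : PMF Z) (n : ℕ) (z : Fin n → Z) :
    iidPMF p n z = ∏ t, p (z t) := by
  let _ : MeasurableSpace Z := ⊤
  change (Measure.pi fun _ : Fin n => p.toMeasure) {z} = _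
  rw [Measure.pi_singleton]
  exact Finset.prod_congr rfl fun t _ => p.toMeasure_apply_singleton _ (measurableSet_singleton _)

open MeasureTheory ProbabilityTheory in
/-- Chebyshev's inequality for the empirical mean of `n` independent letters. -/
lemma tsum_deviation_iidPMF_le {Z : Type*} [Countable Z] (p : PMF Z) {f : Z → ℝ}
    (hf1 : Summable fun z => f z * (p z).toReal) (hf2 : Summable fun z => f z ^ 2 * (p z).toReal) :
    ∃ V : ℝ, ∀ δ : ℝ, 0 < δ → ∀ n : ℕ, 1 ≤ n →
      ∑' z, {z | (n : ℝ) * δ ≤ |∑ t, f (z t) - n * ∑' z, f z * (p z).toReal|}.indicator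
        (fun z => (iidPMF p n z).toReal) z ≤ V / (n * δ ^ 2) := by
  let _ : MeasurableSpace Z := ⊤
  have hint : ∀ {g : Z → ℝ}, Summable (fun z => g z * (p z).toReal) →
      Integrable g p.toMeasure := by
    intro g hg
    refine ⟨(measurable_from_top).aestronglyMeasurable, ?_⟩
    rw [HasFiniteIntegral, lintegral_countable']
    simp_rw [p.toMeasure_apply_singleton _ (measurableSet_singleton _)]
    have := hg.abs
    rw [lt_top_iff_ne_top]
    convert this.tsum_ofReal_ne_top using 4 with z
    rw [abs_mul, ENNReal.ofReal_mul (abs_nonneg _), ENNReal.abs_toReal,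
      ENNReal.ofReal_toReal (p.apply_ne_top z), Real.enorm_eq_ofReal_abs]
  have hL2 : MemLp f 2 p.toMeasure :=
    (memLp_two_iff_integrable_sq measurable_from_top.aestronglyMeasurable).2 (hint hf2)
  have hmean : ∑' z, f z * (p z).toReal = ∫ z, f z ∂p.toMeasure := by
    rw [PMF.integral_eq_tsum p f (hint hf1)]
    simp only [smul_eq_mul, mul_comm]
  refine ⟨Var[f; p.toMeasure], fun δ hδ n hn => ?_⟩
  have hn0 : (0 : ℝ) < n := by exact_mod_cast hn
  set μ : Measure (Fin n → Z) := Measure.pi fun _ : Fin n => p.toMeasure with hμ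
  have hmem : ∀ t : Fin n, MemLp (fun z : Fin n → Z => f (z t)) 2 μ := fun t =>
    hL2.comp_measurePreserving (measurePreserving_eval (fun _ : Fin n => p.toMeasure) t)
  have hsum : MemLp (∑ t : Fin n, fun z : Fin n → Z => f (z t)) 2 μ :=
    memLp_finsetSum' _ fun t _ => hmem t
  have hE : μ[∑ t : Fin n, fun z : Fin n → Z => f (z t)] = n * ∑' z, f z * (p z).toReal := by
    simp only [Finset.sum_apply]
    rw [integral_finsetSum _ fun t _ => (hmem t).integrable (by norm_num)]
    have : ∀ t : Fin n, ∫ z, f (z t) ∂μ = ∫ z, f z ∂p.toMeasure := fun t =>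
      integral_comp_eval (μ := fun _ : Fin n => p.toMeasure)
        measurable_from_top.aestronglyMeasurable
    simp [this, hmean]
  have hcheb := meas_ge_le_variance_div_sq hsum (mul_pos hn0 hδ)
  rw [hE, variance_sum_pi (μ := fun _ : Fin n => p.toMeasure) (X := fun _ => f) fun _ => hL2]
    at hcheb
  have hreal : ∑' z, {z | (n : ℝ) * δ ≤ |∑ t, f (z t) - n * ∑' z, f z * (p z).toReal|}.indicator
        (fun z => (iidPMF p n z).toReal) z
      = μ.real {z | (n : ℝ) * δ ≤ |∑ t, f (z t) - n * ∑' z, f z * (p z).toReal|} := by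
    have hμ' : μ = (iidPMF p n).toMeasure := (Measure.toPMF_toMeasure μ).symm
    rw [measureReal_def, hμ', PMF.toMeasure_apply_eq_tsum, ENNReal.tsum_toReal_eq]
    · refine tsum_congr fun z => ?_
      by_cases h : z ∈ {z : Fin n → Z |
          (n : ℝ) * δ ≤ |∑ t, f (z t) - n * ∑' z, f z * (p z).toReal|}
      · rw [Set.indicator_of_mem h, Set.indicator_of_mem h]
      · rw [Set.indicator_of_notMem h, Set.indicator_of_notMem h, ENNReal.toReal_zero]
    · intro z
      exact ne_top_of_le_ne_top ((iidPMF p n).apply_ne_top z) (Set.indicator_le_self _ _ z)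
  rw [hreal, measureReal_def]
  simp only [Finset.sum_apply] at hcheb
  refine (ENNReal.toReal_le_of_le_ofReal
    (div_nonneg (Finset.sum_nonneg fun _ _ => variance_nonneg _ _) (sq_nonneg _))
      hcheb).trans (le_of_eq ?_)
  simp only [Finset.sum_const, Finset.card_univ, Fintype.card_fin, nsmul_eq_mul]
  field_simp

/-- The memoryless source with single-letter law `P`. -/
def iidSource {X Y : Type*} [Finite X] [Countable Y] (P : PMF (X × Y)) : Source X Y := fun n =>
  (iidPMF P n).map (Equiv.arrowProdEquivProdArrow (Fin n) (fun _ => X) fun _ => Y)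

lemma iidSource_apply {X Y : Type*} [Finite X] [Countable Y] (P : PMF (X × Y)) (n : ℕ)
    (z : Fin n → X × Y) :
    iidSource P n (Equiv.arrowProdEquivProdArrow (Fin n) (fun _ => X) (fun _ => Y) z)
      = iidPMF P n z := by
  classical
  rw [iidSource, PMF.map_apply]
  simp only [EmbeddingLike.apply_eq_iff_eq]
  rw [tsum_eq_single z]
  · simp
  · intro z' h
    simp [h.symm]

lemma prob_iidSource {X Y : Type*} [Finite X] [Countable Y] (P : PMF (X × Y)) (n : ℕ)
    (x : Fin n → X) (y : Fin n → Y) : prob (iidSource P n) x y = ∏ t, prob P (x t) (y t) := by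
  have h := iidSource_apply P n fun t => (x t, y t)
  rw [iidPMF_apply] at h
  simp only [prob]
  rw [← ENNReal.toReal_prod, ← h]
  rfl

lemma isIID_iidSource {X Y : Type*} [Finite X] [Countable Y] (P : PMF (X × Y)) :
    IsIID (iidSource P) P :=
  fun n _ => prob_iidSource P n

/-! ### Conditional probabilities and conditional information -/

/-- `P_{X|Y}(x | y)`, which is `0` when `P_Y(y) = 0`. -/
def condProb {X Y : Type*} [Fintype X] (P : PMF (X × Y)) (x : X) (y : Y) : ℝ :=
  prob P x y / margY P y

/-- The conditional information `-log P_{X|Y}(x | y)`, whose mean is the conditional entropy; it is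
`0`, not `∞`, where the conditional probability vanishes. -/
def condInfo {X Y : Type*} [Fintype X] (P : PMF (X × Y)) (x : X) (y : Y) : ℝ :=
  Real.log (1 / condProb P x y)

/-- The conditional probability of a block of independent letters. -/
def blockProb {X Y : Type*} [Fintype X] (P : PMF (X × Y)) {n : ℕ} (x : Fin n → X)
    (y : Fin n → Y) : ℝ :=
  ∏ t, condProb P (x t) (y t)

/-- The pairs of blocks whose conditional information differs from `n H(X|Y)` by at least
`n δ`. -/
def IsAtypical {X Y : Type*} [Fintype X] (P : PMF (X × Y)) (δ : ℝ) {n : ℕ} (x : Fin n → X)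
    (y : Fin n → Y) : Prop :=
  n * δ ≤ |∑ t, condInfo P (x t) (y t) - n * condEntropy P|

open Classical in
/-- The probability that a block of `n` independent letters is atypical. -/
def atypProb {X Y : Type*} [Fintype X] [Countable Y] (P : PMF (X × Y)) (δ : ℝ) (n : ℕ) : ℝ :=
  expect (iidSource P n) fun x y => if IsAtypical P δ x y then 1 else 0

section

variable {X Y : Type*} [Fintype X] (P : PMF (X × Y))

lemma condProb_nonneg (x : X) (y : Y) : 0 ≤ condProb P x y :=
  div_nonneg (prob_nonneg _ _ _) (margY_nonneg _ _)

lemma condProb_le_one (x : X) (y : Y) : condProb P x y ≤ 1 :=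
  div_le_one_of_le₀ (prob_le_margY _ _ _) (margY_nonneg _ _)

lemma prob_eq_condProb_mul (x : X) (y : Y) : prob P x y = condProb P x y * margY P y := by
  refine (div_mul_cancel_of_imp fun h => ?_).symm
  exact le_antisymm (h ▸ prob_le_margY P x y) (prob_nonneg _ _ _)

lemma condProb_pos {x : X} {y : Y} (h : prob P x y ≠ 0) : 0 < condProb P x y := by
  refine (condProb_nonneg P x y).lt_of_ne fun h0 => h ?_
  rw [prob_eq_condProb_mul, ← h0, zero_mul]

lemma condInfo_nonneg (x : X) (y : Y) : 0 ≤ condInfo P x y := by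
  rcases (condProb_nonneg P x y).eq_or_lt with h | h
  · simp [condInfo, ← h]
  · exact Real.log_nonneg ((one_le_div h).2 (condProb_le_one P x y))

lemma condEntropy_nonneg : 0 ≤ condEntropy P :=
  tsum_nonneg fun y => Finset.sum_nonneg fun x _ =>
    mul_nonneg (prob_nonneg _ _ _) (condInfo_nonneg P x y)

lemma sum_condProb_le_one (y : Y) : ∑ x, condProb P x y ≤ 1 := by
  simp only [condProb, ← Finset.sum_div]
  exact div_self_le_one _

lemma blockProb_nonneg {n : ℕ} (x : Fin n → X) (y : Fin n → Y) : 0 ≤ blockProb P x y :=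
  Finset.prod_nonneg fun _ _ => condProb_nonneg _ _ _

lemma sum_blockProb_le_one {n : ℕ} (y : Fin n → Y) : ∑ x : Fin n → X, blockProb P x y ≤ 1 := by
  simp only [blockProb]
  rw [← Fintype.prod_sum fun (t : Fin n) (x : X) => condProb P x (y t)]
  exact Finset.prod_le_one (fun _ _ => Finset.sum_nonneg fun _ _ => condProb_nonneg _ _ _)
    fun _ _ => sum_condProb_le_one _ _

lemma condInfo_mul_condProb_le (x : X) (y : Y) : condInfo P x y * condProb P x y ≤ 1 := by
  rcases (condProb_nonneg P x y).eq_or_lt with h | h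
  · simp [← h]
  · have := (abs_le.1 (Real.abs_log_mul_self_lt _ h (condProb_le_one P x y)).le).1
    rw [condInfo, one_div, Real.log_inv]
    linarith

lemma condInfo_sq_mul_condProb_le (x : X) (y : Y) : condInfo P x y ^ 2 * condProb P x y ≤ 4 := by
  rcases (condProb_nonneg P x y).eq_or_lt with h | h
  · simp [← h]
  · have h2 := Real.abs_log_mul_self_rpow_lt _ (1 / 2) h (condProb_le_one P x y) (by norm_num)
    rw [← Real.sqrt_eq_rpow] at h2
    have h3 : (Real.log (condProb P x y) * √(condProb P x y)) ^ 2 ≤ 2 ^ 2 :=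
      sq_le_sq.2 (by rw [abs_of_pos (two_pos (α := ℝ))]; exact h2.le.trans (by norm_num))
    rw [mul_pow, Real.sq_sqrt h.le] at h3
    rw [condInfo, one_div, Real.log_inv, neg_sq]
    linarith

lemma summable_margY_snd : Summable fun z : X × Y => margY P z.2 := by
  have := (Summable.of_finite (f := fun _ : X => (1 : ℝ))).mul_of_nonneg (summable_margY P)
    (fun _ => zero_le_one) (margY_nonneg P)
  simpa using this

lemma summable_condInfo : Summable fun z : X × Y => condInfo P z.1 z.2 * (P z).toReal := by
  refine Summable.of_nonneg_of_le
    (fun z => mul_nonneg (condInfo_nonneg P _ _) ENNReal.toReal_nonneg) (fun z => ?_)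
    (summable_margY_snd P)
  change _ * prob P z.1 z.2 ≤ _
  rw [prob_eq_condProb_mul, ← mul_assoc]
  exact mul_le_of_le_one_left (margY_nonneg _ _) (condInfo_mul_condProb_le P _ _)

lemma summable_condInfo_sq : Summable fun z : X × Y => condInfo P z.1 z.2 ^ 2 * (P z).toReal := by
  refine Summable.of_nonneg_of_le (fun z => mul_nonneg (sq_nonneg _) ENNReal.toReal_nonneg)
    (fun z => ?_) ((summable_margY_snd P).mul_left 4)
  change _ * prob P z.1 z.2 ≤ _
  rw [prob_eq_condProb_mul, ← mul_assoc]
  exact mul_le_mul_of_nonneg_right (condInfo_sq_mul_condProb_le P _ _) (margY_nonneg _ _)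

lemma condEntropy_eq_tsum : condEntropy P = ∑' z : X × Y, condInfo P z.1 z.2 * (P z).toReal := by
  rw [← tsum_sum_eq_tsum_prod (summable_condInfo P)]
  refine tsum_congr fun y => Finset.sum_congr rfl fun x _ => ?_
  rw [mul_comm]
  rfl

lemma abs_ite_le_one (p : Prop) [Decidable p] : |(if p then 1 else 0 : ℝ)| ≤ 1 := by
  split_ifs <;> simp

lemma atypProb_nonneg [Countable Y] (δ : ℝ) (n : ℕ) : 0 ≤ atypProb P δ n :=
  expect_nonneg _ fun _ _ => by split_ifs <;> norm_num

/-- The weak law of large numbers for the conditional information. -/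
lemma tendsto_atypProb [Countable Y] {δ : ℝ} (hδ : 0 < δ) :
    Tendsto (atypProb P δ) atTop (𝓝 0) := by
  classical
  obtain ⟨V, hV⟩ := tsum_deviation_iidPMF_le P (summable_condInfo P) (summable_condInfo_sq P)
  have hlim : Tendsto (fun n : ℕ => V / (n * δ ^ 2)) atTop (𝓝 0) :=
    (tendsto_natCast_atTop_atTop.atTop_mul_const (by positivity)).const_div_atTop V
  refine tendsto_of_tendsto_of_tendsto_of_le_of_le' tendsto_const_nhds hlim
    (Eventually.of_forall fun n => atypProb_nonneg P δ n) ?_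
  filter_upwards [eventually_ge_atTop 1] with n hn
  refine le_of_eq_of_le ?_ (hV δ hδ n hn)
  rw [atypProb, expect_eq_tsum_prod _ (C := 1) fun x y => abs_ite_le_one _,
    ← (Equiv.arrowProdEquivProdArrow (Fin n) (fun _ => X) fun _ => Y).tsum_eq]
  refine tsum_congr fun z => ?_
  rw [prob, Prod.mk.eta, iidSource_apply, Set.indicator_apply, ite_mul, one_mul, zero_mul,
    ← condEntropy_eq_tsum]
  rfl

lemma prob_ne_zero_of_iidSource [Countable Y] {n : ℕ} {x : Fin n → X} {y : Fin n → Y}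
    (h : prob (iidSource P n) x y ≠ 0) (t : Fin n) : prob P (x t) (y t) ≠ 0 := by
  rw [prob_iidSource] at h
  exact Finset.prod_ne_zero_iff.1 h t (Finset.mem_univ t)

/-- The hypothesis is needed because `condInfo` takes the value `0` on pairs of probability `0`. -/
lemma blockProb_eq_exp [Countable Y] {n : ℕ} {x : Fin n → X} {y : Fin n → Y}
    (h : prob (iidSource P n) x y ≠ 0) :
    blockProb P x y = Real.exp (-∑ t, condInfo P (x t) (y t)) := by
  rw [← Finset.sum_neg_distrib, Real.exp_sum]
  refine Finset.prod_congr rfl fun t _ => ?_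
  rw [condInfo, one_div, Real.log_inv, neg_neg,
    Real.exp_log (condProb_pos P (prob_ne_zero_of_iidSource P h t))]

lemma margY_iidSource [Countable Y] {n : ℕ} (y : Fin n → Y) :
    margY (iidSource P n) y = ∏ t, margY P (y t) := by
  simp only [margY, prob_iidSource]
  exact (Fintype.prod_sum fun (t : Fin n) (x : X) => prob P x (y t)).symm

lemma prob_iidSource_eq_blockProb_mul [Countable Y] {n : ℕ} (x : Fin n → X) (y : Fin n → Y) :
    prob (iidSource P n) x y = blockProb P x y * margY (iidSource P n) y := by
  rw [margY_iidSource, prob_iidSource, blockProb, ← Finset.prod_mul_distrib]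
  exact Finset.prod_congr rfl fun t _ => prob_eq_condProb_mul _ _ _

lemma blockProb_le_of_not_isAtypical [Countable Y] {δ : ℝ} {n : ℕ} {x : Fin n → X}
    {y : Fin n → Y} (h : prob (iidSource P n) x y ≠ 0) (ht : ¬ IsAtypical P δ x y) :
    blockProb P x y ≤ Real.exp (-(n * (condEntropy P - δ))) := by
  rw [blockProb_eq_exp P h, Real.exp_le_exp]
  have := (abs_lt.1 (not_le.1 ht)).1
  linarith

lemma le_blockProb_of_not_isAtypical [Countable Y] {δ : ℝ} {n : ℕ} {x : Fin n → X}
    {y : Fin n → Y} (h : prob (iidSource P n) x y ≠ 0) (ht : ¬ IsAtypical P δ x y) :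
    Real.exp (-(n * (condEntropy P + δ))) ≤ blockProb P x y := by
  rw [blockProb_eq_exp P h, Real.exp_le_exp]
  have := (abs_lt.1 (not_le.1 ht)).2
  linarith

end

/-! ### Guessing strategies -/

section

variable {A B : Type*} [Fintype A]

lemma Strategy.survive_nonneg (G : Strategy A B) (y : B) (i : Fin (Fintype.card A)) :
    0 ≤ G.survive y i :=
  Finset.prod_nonneg fun j _ => sub_nonneg.2 (G.quit_le_one y j)

lemma Strategy.survive_le_one (G : Strategy A B) (y : B) (i : Fin (Fintype.card A)) :
    G.survive y i ≤ 1 :=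
  Finset.prod_le_one (fun j _ => sub_nonneg.2 (G.quit_le_one y j))
    fun j _ => sub_le_self 1 (G.quit_nonneg y j)

lemma Strategy.abs_survive_le_one (G : Strategy A B) (y : B) (i : Fin (Fintype.card A)) :
    |G.survive y i| ≤ 1 :=
  (abs_of_nonneg (G.survive_nonneg y i)).trans_le (G.survive_le_one y i)

lemma Strategy.errorProb_eq (G : Strategy A B) (Q : PMF (A × B)) :
    G.errorProb Q = 1 - expect Q fun x y => G.survive y (G.σ y x) := rfl

lemma Strategy.cost_eq (G : Strategy A B) (ρ : ℝ) (Q : PMF (A × B)) :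
    G.cost ρ Q = expect Q fun x y => G.survive y (G.σ y x) * (((G.σ y x : ℕ) : ℝ) + 1) ^ ρ := by
  refine tsum_congr fun y => Finset.sum_congr rfl fun x _ => ?_
  ring

lemma Strategy.abs_survive_mul_rpow_le (G : Strategy A B) {ρ : ℝ} (hρ : 0 < ρ) (x : A) (y : B) :
    |G.survive y (G.σ y x) * (((G.σ y x : ℕ) : ℝ) + 1) ^ ρ| ≤ (Fintype.card A : ℝ) ^ ρ := by
  have h0 : (0 : ℝ) ≤ ((G.σ y x : ℕ) : ℝ) + 1 := by positivity
  rw [abs_of_nonneg (mul_nonneg (G.survive_nonneg _ _) (Real.rpow_nonneg h0 _))]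
  refine (mul_le_of_le_one_left (Real.rpow_nonneg h0 _) (G.survive_le_one _ _)).trans ?_
  exact Real.rpow_le_rpow h0 (by exact_mod_cast (G.σ y x).isLt) hρ.le

/-- The elements of a finite type can be enumerated so that those of `T` come first. -/
lemma exists_equiv_fin_lt_card_iff (T : Finset A) :
    ∃ e : A ≃ Fin (Fintype.card A), ∀ x, (e x : ℕ) < T.card ↔ x ∈ T := by
  classical
  have hc : T.card + Fintype.card {x // x ∉ T} = Fintype.card A := by
    rw [← Fintype.card_coe T, ← Fintype.card_sum]
    exact Fintype.card_congr (Equiv.sumCompl (· ∈ T))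
  let e : A ≃ Fin (Fintype.card A) := (Equiv.sumCompl (· ∈ T)).symm.trans
    (((Equiv.sumCongr T.equivFin (Fintype.equivFin {x // x ∉ T})).trans finSumFinEquiv).trans
      (finCongr hc))
  refine ⟨e, fun x => ?_⟩
  by_cases hx : x ∈ T
  · have : (e x : ℕ) = T.equivFin ⟨x, hx⟩ := by
      simp [e, Equiv.sumCompl_symm_apply_of_pos hx]
    simp [this, hx]
  · have : (e x : ℕ) = T.card + Fintype.equivFin {x // x ∉ T} ⟨x, hx⟩ := by
      simp [e, Equiv.sumCompl_symm_apply_of_neg hx]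
    simp [this, hx]

/-- Guess the elements of `T y` one after the other, then give up. -/
lemma exists_strategy_of_lists (T : B → Finset A) : ∃ G : Strategy A B, ∀ x y,
    (x ∈ T y → G.survive y (G.σ y x) = 1 ∧ (G.σ y x : ℕ) < (T y).card) ∧
    (x ∉ T y → G.survive y (G.σ y x) = 0) := by
  choose e he using fun y => exists_equiv_fin_lt_card_iff (T y)
  refine ⟨⟨e, fun y i => if (i : ℕ) < (T y).card then 0 else 1, fun y i => ?_, fun y i => ?_⟩,
    fun x y => ⟨fun hx => ⟨?_, (he y x).2 hx⟩, fun hx => ?_⟩⟩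
  · split_ifs <;> norm_num
  · split_ifs <;> norm_num
  · refine Finset.prod_eq_one fun j hj => ?_
    have hj' : (j : ℕ) ≤ e y x := Fin.le_def.1 (Finset.mem_Iic.1 hj)
    simp [hj'.trans_lt ((he y x).2 hx)]
  · refine Finset.prod_eq_zero (Finset.mem_Iic.2 le_rfl) ?_
    have : ¬ (e y x : ℕ) < (T y).card := fun h => hx ((he y x).1 h)
    simp [this]

end

/-! ### Achievability -/

/-- Lists made of the blocks to which one of several laws gives conditional probability at least
`exp (-r)` are short, since each conditional law has total mass at most `1`. -/
lemma card_filter_le_sum_blockProb {X Y : Type*} [Fintype X] {m n : ℕ} (P : Fin m → PMF (X × Y))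
    (r : ℝ) (y : Fin n → Y) [DecidablePred fun x => Real.exp (-r) ≤ ∑ j, blockProb (P j) x y] :
    ((Finset.univ.filter fun x => Real.exp (-r) ≤ ∑ j, blockProb (P j) x y).card : ℝ)
      ≤ m * Real.exp r := by
  set T := Finset.univ.filter fun x => Real.exp (-r) ≤ ∑ j, blockProb (P j) x y with hT
  have h1 : (T.card : ℝ) * Real.exp (-r) ≤ ∑ x ∈ T, ∑ j, blockProb (P j) x y := by
    rw [← nsmul_eq_mul]
    exact Finset.card_nsmul_le_sum _ _ _ fun x hx => (Finset.mem_filter.1 hx).2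
  have h2 : ∑ x ∈ T, ∑ j, blockProb (P j) x y ≤ m := by
    calc ∑ x ∈ T, ∑ j, blockProb (P j) x y ≤ ∑ x, ∑ j, blockProb (P j) x y :=
          Finset.sum_le_univ_sum_of_nonneg fun x => Finset.sum_nonneg fun j _ =>
            blockProb_nonneg _ _ _
      _ = ∑ j, ∑ x, blockProb (P j) x y := Finset.sum_comm
      _ ≤ ∑ _j : Fin m, (1 : ℝ) := Finset.sum_le_sum fun j _ => sum_blockProb_le_one _ _
      _ = m := by simp
  rw [Real.exp_neg, ← div_eq_mul_inv] at h1
  exact (div_le_iff₀ (Real.exp_pos r)).1 (h1.trans h2)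

section

variable {X Y : Type*} [Fintype X] [Countable Y] {m : ℕ} {P : Fin m → PMF (X × Y)}
  {α : Fin m → ℝ} {S : Source X Y}

lemma IsMixture.prob_eq (hS : IsMixture S P α) {n : ℕ} (hn : 1 ≤ n) (x : Fin n → X)
    (y : Fin n → Y) : prob (S n) x y = ∑ i, α i * prob (iidSource (P i) n) x y := by
  simp only [hS.law n hn, prob_iidSource]

/-- Guessing all blocks that are likely under some component and then giving up fails, under a
component of entropy at most `H(P i)`, only on atypical blocks. -/
lemma IsMixture.exists_strategy (hS : IsMixture S P α) {ρ δ : ℝ} (hρ : 0 < ρ) {i : Fin m}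
    (hi : ∀ j, i ≤ j → condEntropy (P j) ≤ condEntropy (P i)) {n : ℕ} (hn : 1 ≤ n) :
    ∃ G : Strategy (Fin n → X) (Fin n → Y),
      G.errorProb (S n) ≤ ∑ j ∈ Finset.Iio i, α j + ∑ j, α j * atypProb (P j) δ n ∧
      0 ≤ G.cost ρ (S n) ∧
      G.cost ρ (S n) ≤ (m * Real.exp (n * (condEntropy (P i) + δ))) ^ ρ := by
  classical
  set r := n * (condEntropy (P i) + δ) with hr
  obtain ⟨G, hG⟩ := exists_strategy_of_lists fun y : Fin n → Y =>
    Finset.univ.filter fun x : Fin n → X => Real.exp (-r) ≤ ∑ j, blockProb (P j) x y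
  simp only [Finset.mem_filter, Finset.mem_univ, true_and] at hG
  refine ⟨G, ?_, ?_, ?_⟩
  · have habs : ∀ x y, |G.survive y (G.σ y x)| ≤ 1 := fun x y => G.abs_survive_le_one _ _
    rw [G.errorProb_eq, expect_mixture (hS.prob_eq hn) habs, ← hS.sum_eq_one,
      ← Finset.sum_sub_distrib]
    have hIio : ∑ j ∈ Finset.Iio i, α j = ∑ j, if j < i then α j else 0 := by
      rw [← Finset.sum_filter]
      exact Finset.sum_congr (by ext; simp) fun _ _ => rfl
    rw [hIio, ← Finset.sum_add_distrib]
    refine Finset.sum_le_sum fun j _ => ?_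
    have hα := (hS.pos j).le
    split_ifs with hj
    · have h1 := mul_nonneg hα (expect_nonneg (iidSource (P j) n)
        (F := fun x y => G.survive y (G.σ y x)) fun x y => G.survive_nonneg _ _)
      have h2 := mul_nonneg hα (atypProb_nonneg (P j) δ n)
      linarith
    · rw [zero_add, ← mul_one_sub]
      refine mul_le_mul_of_nonneg_left (sub_le_iff_le_add.2 ?_) hα
      refine (expect_const (iidSource (P j) n) 1).symm.trans_le ?_
      rw [atypProb, ← expect_add _ (fun x y => abs_ite_le_one _) habs]
      refine expect_mono _ (C := 1) (C' := 2) (fun _ _ => by simp) (fun x y => ?_)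
        fun x y hp => ?_
      · exact (abs_add_le _ _).trans (by
          linarith [abs_ite_le_one (IsAtypical (P j) δ x y), habs x y])
      · split_ifs with hat
        · linarith [G.survive_nonneg y (G.σ y x)]
        · rw [zero_add, ((hG x y).1 _).1]
          refine le_trans ?_ ((le_blockProb_of_not_isAtypical (P j) hp hat).trans
            (Finset.single_le_sum (f := fun j => blockProb (P j) x y)
              (fun _ _ => blockProb_nonneg _ _ _) (Finset.mem_univ j)))
          rw [Real.exp_le_exp, neg_le_neg_iff, hr]
          have := hi j (not_lt.1 hj)
          gcongr
  · rw [G.cost_eq]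
    exact expect_nonneg _ fun x y => mul_nonneg (G.survive_nonneg _ _) (by positivity)
  · rw [G.cost_eq, ← expect_const (S n) ((m * Real.exp r) ^ ρ)]
    refine expect_mono _ (G.abs_survive_mul_rpow_le hρ) (fun _ _ => le_rfl) fun x y _ => ?_
    by_cases hx : Real.exp (-r) ≤ ∑ j, blockProb (P j) x y
    · obtain ⟨h1, h2⟩ := (hG x y).1 hx
      rw [h1, one_mul]
      refine Real.rpow_le_rpow (by positivity) (le_trans ?_ (card_filter_le_sum_blockProb P r y))
        hρ.le
      exact_mod_cast h2
    · rw [(hG x y).2 hx, zero_mul]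
      positivity

lemma IsMixture.isAchievable (hS : IsMixture S P α) {ρ ε δ : ℝ} (hρ : 0 < ρ) (hδ : 0 < δ)
    {i : Fin m} (hi : ∀ j, i ≤ j → condEntropy (P j) ≤ condEntropy (P i))
    (hε : ∑ j ∈ Finset.Iio i, α j ≤ ε) :
    IsAchievable S ρ ε (ρ * (condEntropy (P i) + 2 * δ)) := by
  have hH := condEntropy_nonneg (P i)
  have hm : (1 : ℝ) ≤ m := by exact_mod_cast i.pos
  have hex : ∀ n : ℕ, ∃ G : Strategy (Fin n → X) (Fin n → Y), 1 ≤ n →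
      G.errorProb (S n) ≤ ∑ j ∈ Finset.Iio i, α j + ∑ j, α j * atypProb (P j) δ n ∧
      0 ≤ G.cost ρ (S n) ∧
      G.cost ρ (S n) ≤ (m * Real.exp (n * (condEntropy (P i) + δ))) ^ ρ := by
    intro n
    by_cases hn : 1 ≤ n
    · obtain ⟨G, hG⟩ := hS.exists_strategy hρ (δ := δ) hi hn
      exact ⟨G, fun _ => hG⟩
    · obtain ⟨G, -⟩ := exists_strategy_of_lists fun _ : Fin n → Y => (∅ : Finset (Fin n → X))
      exact ⟨G, fun h => absurd h hn⟩
  choose G hG using hex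
  refine ⟨G, ?_, ?_⟩
  · have hlim : Tendsto (fun n => ∑ j ∈ Finset.Iio i, α j + ∑ j, α j * atypProb (P j) δ n) atTop
        (𝓝 (∑ j ∈ Finset.Iio i, α j)) := by
      have : Tendsto (fun n => ∑ j, α j * atypProb (P j) δ n) atTop (𝓝 (∑ j : Fin m, α j * 0)) :=
        tendsto_finsetSum _ fun j _ => (tendsto_atypProb (P j) hδ).const_mul (α j)
      simpa using this.const_add (∑ j ∈ Finset.Iio i, α j)
    have hlimE := (continuous_coe_real_ereal.tendsto _).comp hlim
    refine le_trans ?_ (EReal.coe_le_coe_iff.2 hε)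
    rw [← hlimE.limsup_eq]
    refine limsup_le_limsup ?_
    filter_upwards [eventually_ge_atTop 1] with n hn
    exact EReal.coe_le_coe_iff.2 (hG n hn).1
  · refine limsup_le_of_le (h := ?_)
    have hlog : ∀ᶠ n : ℕ in atTop, Real.log m / n < δ :=
      (tendsto_const_div_atTop_nhds_zero_nat (Real.log m)).eventually_lt_const hδ
    filter_upwards [eventually_ge_atTop 1, hlog] with n hn hlogn
    rw [EReal.coe_le_coe_iff]
    obtain ⟨-, hc0, hc⟩ := hG n hn
    have hn0 : (0 : ℝ) < n := by exact_mod_cast hn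
    have hB : 1 ≤ m * Real.exp (n * (condEntropy (P i) + δ)) :=
      one_le_mul_of_one_le_of_one_le hm (Real.one_le_exp (by positivity))
    have hle : Real.log ((G n).cost ρ (S n))
        ≤ ρ * (Real.log m + n * (condEntropy (P i) + δ)) := by
      rw [← Real.log_exp (n * (condEntropy (P i) + δ)),
        ← Real.log_mul (by positivity) (Real.exp_ne_zero _), ← Real.log_rpow (by positivity)]
      -- A vanishing cost is covered as well: its logarithm is `0`, and the bound is at least `1`.
      rcases hc0.eq_or_lt with h0 | h0
      · rw [← h0, Real.log_zero]
        exact Real.log_nonneg (Real.one_le_rpow hB hρ.le)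
      · exact Real.log_le_log h0 hc
    rw [one_div, inv_mul_le_iff₀ hn0]
    rw [div_lt_iff₀ hn0] at hlogn
    nlinarith

/-! ### Converse -/

/-- Under a single memoryless component, the probability of a correct guess is at most the sum of
three parts: the atypical blocks, the typical blocks guessed in the first `M` steps, each of
conditional probability at most `exp (-n (H - δ))`, and the later guesses, which cost more than
`M ^ ρ`. -/
lemma expect_survive_le (Q : PMF (X × Y)) {ρ δ M : ℝ} (hρ : 0 < ρ) (hM : 0 < M) {n : ℕ}
    (G : Strategy (Fin n → X) (Fin n → Y)) :
    expect (iidSource Q n) (fun x y => G.survive y (G.σ y x)) ≤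
      atypProb Q δ n + M * Real.exp (-(n * (condEntropy Q - δ))) +
        M ^ (-ρ) * G.cost ρ (iidSource Q n) := by
  classical
  set q := Real.exp (-(n * (condEntropy Q - δ))) with hq
  let F1 : (Fin n → X) → (Fin n → Y) → ℝ := fun x y => if IsAtypical Q δ x y then 1 else 0
  let F2 : (Fin n → X) → (Fin n → Y) → ℝ := fun x y =>
    if ((G.σ y x : ℕ) : ℝ) + 1 ≤ M ∧ blockProb Q x y ≤ q then 1 else 0
  let F3 : (Fin n → X) → (Fin n → Y) → ℝ := fun x y =>
    M ^ (-ρ) * (G.survive y (G.σ y x) * (((G.σ y x : ℕ) : ℝ) + 1) ^ ρ)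
  have h1 : ∀ x y, |F1 x y| ≤ 1 := fun x y => abs_ite_le_one _
  have h2 : ∀ x y, |F2 x y| ≤ 1 := fun x y => abs_ite_le_one _
  have h12 : ∀ x y, |F1 x y + F2 x y| ≤ 1 + 1 := fun x y =>
    (abs_add_le _ _).trans (add_le_add (h1 x y) (h2 x y))
  have h3 : ∀ x y, |F3 x y| ≤ M ^ (-ρ) * (Fintype.card (Fin n → X) : ℝ) ^ ρ := fun x y => by
    rw [abs_mul, abs_of_pos (Real.rpow_pos_of_pos hM _)]
    exact mul_le_mul_of_nonneg_left (G.abs_survive_mul_rpow_le hρ x y)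
      (Real.rpow_nonneg hM.le _)
  have hF3 : expect (iidSource Q n) F3 = M ^ (-ρ) * G.cost ρ (iidSource Q n) := by
    rw [G.cost_eq, ← expect_const_mul]
  have hF2 : expect (iidSource Q n) F2 ≤ M * q := by
    have hs := summable_margY (iidSource Q n)
    have ht := tsum_margY (iidSource Q n)
    calc expect (iidSource Q n) F2 ≤ ∑' y, M * q * margY (iidSource Q n) y := by
          refine (summable_expect _ h2).tsum_le_tsum (fun y => ?_) (hs.mul_left _)
          have hcard : (((Finset.univ.filter fun x : Fin n → X =>
              ((G.σ y x : ℕ) : ℝ) + 1 ≤ M).card : ℕ) : ℝ) ≤ M := by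
            have : (Finset.univ.filter fun x : Fin n → X => ((G.σ y x : ℕ) : ℝ) + 1 ≤ M).card
                ≤ (Finset.range ⌊M⌋₊).card := by
              refine Finset.card_le_card_of_injOn (fun x => (G.σ y x : ℕ)) (fun x hx => ?_)
                fun x _ x' _ h => (G.σ y).injective (Fin.ext h)
              have hx' := (Finset.mem_filter.1 hx).2
              rw [Finset.mem_coe, Finset.mem_range, ← Nat.succ_le_iff, Nat.le_floor_iff hM.le]
              push_cast
              exact hx'
            rw [Finset.card_range] at this
            exact (Nat.cast_le.2 this).trans (Nat.floor_le hM.le)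
          calc ∑ x, F2 x y * prob (iidSource Q n) x y
              ≤ ∑ x, if ((G.σ y x : ℕ) : ℝ) + 1 ≤ M then q * margY (iidSource Q n) y else 0 := by
                refine Finset.sum_le_sum fun x _ => ?_
                have hm := margY_nonneg (iidSource Q n) y
                simp only [F2]
                split_ifs with ha hb hb
                · rw [one_mul, prob_iidSource_eq_blockProb_mul]
                  exact mul_le_mul_of_nonneg_right ha.2 hm
                · exact absurd ha.1 hb
                · rw [zero_mul]
                  positivity
                · rw [zero_mul]
            _ = ((Finset.univ.filter fun x : Fin n → X =>
                  ((G.σ y x : ℕ) : ℝ) + 1 ≤ M).card : ℝ) * (q * margY (iidSource Q n) y) := by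
                rw [← Finset.sum_filter, Finset.sum_const, nsmul_eq_mul]
            _ ≤ M * (q * margY (iidSource Q n) y) :=
                mul_le_mul_of_nonneg_right hcard
                  (mul_nonneg (Real.exp_pos _).le (margY_nonneg _ _))
            _ = M * q * margY (iidSource Q n) y := by ring
      _ = M * q := by rw [tsum_mul_left, ht, mul_one]
  -- `F1` bounds the atypical blocks, `F2` the early guesses of typical blocks, `F3` the late ones.
  calc expect (iidSource Q n) (fun x y => G.survive y (G.σ y x))
      ≤ expect (iidSource Q n) fun x y => (F1 x y + F2 x y) + F3 x y := by
        refine expect_mono _ (fun x y => G.abs_survive_le_one _ _)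
          (fun x y => (abs_add_le _ _).trans (add_le_add (h12 x y) (h3 x y))) fun x y hp => ?_
        have h0 := G.survive_nonneg y (G.σ y x)
        have hle := G.survive_le_one y (G.σ y x)
        have h30 : 0 ≤ F3 x y :=
          mul_nonneg (Real.rpow_nonneg hM.le _) (mul_nonneg h0 (by positivity))
        have h10 : 0 ≤ F1 x y := by simp only [F1]; split_ifs <;> norm_num
        have h20 : 0 ≤ F2 x y := by simp only [F2]; split_ifs <;> norm_num
        by_cases hat : IsAtypical Q δ x y
        · have : F1 x y = 1 := if_pos hat
          linarith
        by_cases hearly : ((G.σ y x : ℕ) : ℝ) + 1 ≤ M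
        · have : F2 x y = 1 := if_pos ⟨hearly, blockProb_le_of_not_isAtypical Q hp hat⟩
          linarith
        · have hpow : M ^ ρ ≤ (((G.σ y x : ℕ) : ℝ) + 1) ^ ρ :=
            Real.rpow_le_rpow hM.le (not_le.1 hearly).le hρ.le
          have : G.survive y (G.σ y x) ≤ F3 x y := by
            simp only [F3]
            rw [mul_left_comm, Real.rpow_neg hM.le, ← div_eq_inv_mul]
            exact le_mul_of_one_le_right h0 ((one_le_div (Real.rpow_pos_of_pos hM _)).2 hpow)
          linarith
    _ = expect (iidSource Q n) F1 + expect (iidSource Q n) F2 + expect (iidSource Q n) F3 := by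
        rw [expect_add _ h12 h3, expect_add _ h1 h2]
    _ ≤ _ := by
        rw [hF3]
        have : expect (iidSource Q n) F1 = atypProb Q δ n := rfl
        linarith

/-- The components up to `i`, of entropy at least `H(P i)`, force a large cost as soon as the error
probability stays below their total weight. -/
lemma IsMixture.le_cost (hS : IsMixture S P α) {ρ δ : ℝ} (hρ : 0 < ρ) {i : Fin m}
    (hi : ∀ j, j ≤ i → condEntropy (P i) ≤ condEntropy (P j)) {n : ℕ} (hn : 1 ≤ n)
    (G : Strategy (Fin n → X) (Fin n → Y)) :
    ∑ j ∈ Finset.Iic i, α j - G.errorProb (S n) - ∑ j, α j * atypProb (P j) δ n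
        - Real.exp (-(n * δ))
      ≤ Real.exp (n * (condEntropy (P i) - 2 * δ)) ^ (-ρ) * G.cost ρ (S n) := by
  set M := Real.exp (n * (condEntropy (P i) - 2 * δ)) with hMdef
  have hM : 0 < M := Real.exp_pos _
  have hbd := G.abs_survive_mul_rpow_le hρ
  rw [G.errorProb_eq, expect_mixture (hS.prob_eq hn) (fun x y => G.abs_survive_le_one _ _),
    G.cost_eq, expect_mixture (hS.prob_eq hn) hbd]
  -- A component beyond `i` is bounded by its weight alone; `expect_survive_le` handles the others.
  have hterm : ∀ j, α j * expect (iidSource (P j) n) (fun x y => G.survive y (G.σ y x)) ≤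
      (α j - if j ≤ i then α j else 0) + α j * atypProb (P j) δ n + α j * Real.exp (-(n * δ)) +
      M ^ (-ρ) * (α j * expect (iidSource (P j) n)
        (fun x y => G.survive y (G.σ y x) * (((G.σ y x : ℕ) : ℝ) + 1) ^ ρ)) := by
    intro j
    have hα := (hS.pos j).le
    rw [← G.cost_eq]
    have hcost : 0 ≤ G.cost ρ (iidSource (P j) n) := by
      rw [G.cost_eq]
      exact expect_nonneg _ fun x y => mul_nonneg (G.survive_nonneg _ _) (by positivity)
    split_ifs with hj
    · have h1 := expect_survive_le (P j) (δ := δ) hρ hM G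
      have h2 : M * Real.exp (-(n * (condEntropy (P j) - δ))) ≤ Real.exp (-(n * δ)) := by
        rw [hMdef, ← Real.exp_add, Real.exp_le_exp]
        nlinarith [mul_le_mul_of_nonneg_left (hi j hj) (Nat.cast_nonneg (α := ℝ) n)]
      have h3 := mul_le_mul_of_nonneg_left
        (h1.trans (add_le_add_left (add_le_add_right h2 _) _)) hα
      linarith
    · have h1 : expect (iidSource (P j) n) (fun x y => G.survive y (G.σ y x)) ≤ 1 := by
        rw [← expect_const (iidSource (P j) n) 1]
        exact expect_mono _ (fun x y => G.abs_survive_le_one _ _) (fun _ _ => le_rfl)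
          fun x y _ => G.survive_le_one _ _
      have h2 := mul_le_mul_of_nonneg_left h1 hα
      have h3 := mul_nonneg hα (atypProb_nonneg (P j) δ n)
      have h4 := mul_nonneg hα (Real.exp_pos (-(n * δ))).le
      have h5 := mul_nonneg (Real.rpow_nonneg hM.le (-ρ)) (mul_nonneg hα hcost)
      linarith
  have hsum := Finset.sum_le_sum fun j (_ : j ∈ Finset.univ) => hterm j
  rw [Finset.sum_add_distrib, Finset.sum_add_distrib, Finset.sum_add_distrib,
    Finset.sum_sub_distrib, ← Finset.sum_mul, ← Finset.mul_sum, hS.sum_eq_one] at hsum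
  have hIic : ∑ j ∈ Finset.Iic i, α j = ∑ j, if j ≤ i then α j else 0 := by
    rw [← Finset.sum_filter]
    exact Finset.sum_congr (by ext; simp) fun _ _ => rfl
  rw [hIic]
  linarith

lemma IsMixture.le_of_isAchievable (hS : IsMixture S P α) {ρ ε E : ℝ} (hρ : 0 < ρ) {i : Fin m}
    (hi : ∀ j, j ≤ i → condEntropy (P i) ≤ condEntropy (P j))
    (hε : ε < ∑ j ∈ Finset.Iic i, α j) (hE : IsAchievable S ρ ε E) :
    ρ * condEntropy (P i) ≤ E := by
  obtain ⟨G, hG1, hG2⟩ := hE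
  suffices h : ∀ δ : ℝ, 0 < δ → ρ * (condEntropy (P i) - 3 * δ) ≤ E by
    refine le_of_forall_pos_le_add fun η hη => ?_
    have := h (η / (3 * ρ)) (by positivity)
    have h' : ρ * (3 * (η / (3 * ρ))) = η := by field_simp
    linarith [mul_sub ρ (condEntropy (P i)) (3 * (η / (3 * ρ)))]
  intro δ hδ
  obtain ⟨ε', hε1, hε2⟩ := exists_between hε
  have herr : ∀ᶠ n in atTop, (G n).errorProb (S n) < ε' := by
    filter_upwards [eventually_lt_of_limsup_lt (hG1.trans_lt (EReal.coe_lt_coe_iff.2 hε1))]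
      with n hn using EReal.coe_lt_coe_iff.1 hn
  -- Half of the gap absorbs the vanishing terms of `le_cost`; the other half bounds the cost below.
  set c := (∑ j ∈ Finset.Iic i, α j - ε') / 2 with hc
  have hc0 : 0 < c := by linarith
  have hsmall : ∀ᶠ n : ℕ in atTop,
      ∑ j, α j * atypProb (P j) δ n + Real.exp (-(n * δ)) < c := by
    have h1 : Tendsto (fun n => ∑ j, α j * atypProb (P j) δ n) atTop (𝓝 (∑ j : Fin m, α j * 0)) :=
      tendsto_finsetSum _ fun j _ => (tendsto_atypProb (P j) hδ).const_mul (α j)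
    have h2 : Tendsto (fun n : ℕ => Real.exp (-(n * δ))) atTop (𝓝 0) :=
      Real.tendsto_exp_neg_atTop_nhds_zero.comp (tendsto_natCast_atTop_atTop.atTop_mul_const hδ)
    have h3 := h1.add h2
    simp only [mul_zero, Finset.sum_const_zero, add_zero] at h3
    exact h3.eventually_lt_const hc0
  have hlog : ∀ᶠ n : ℕ in atTop, -(ρ * δ) < Real.log c / n :=
    (tendsto_const_div_atTop_nhds_zero_nat (Real.log c)).eventually_const_lt
      (by linarith [mul_pos hρ hδ])
  rw [← EReal.coe_le_coe_iff]
  refine le_trans ?_ hG2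
  refine le_trans ?_ (liminf_le_limsup)
  refine le_liminf_of_le (h := ?_)
  filter_upwards [eventually_ge_atTop 1, herr, hsmall, hlog] with n hn h1 h2 h3
  rw [EReal.coe_le_coe_iff]
  have hn0 : (0 : ℝ) < n := by exact_mod_cast hn
  have hcost := hS.le_cost (δ := δ) hρ hi hn (G n)
  rw [← Real.exp_mul] at hcost
  have hlow : c * Real.exp (n * (condEntropy (P i) - 2 * δ) * ρ) ≤ (G n).cost ρ (S n) := by
    have : c ≤ Real.exp (n * (condEntropy (P i) - 2 * δ) * -ρ) * (G n).cost ρ (S n) := by linarith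
    rw [mul_neg, Real.exp_neg, ← div_eq_inv_mul] at this
    exact (le_div_iff₀ (Real.exp_pos _)).1 this
  have hl := Real.log_le_log (mul_pos hc0 (Real.exp_pos _)) hlow
  rw [Real.log_mul hc0.ne' (Real.exp_ne_zero _), Real.log_exp] at hl
  rw [one_div, le_inv_mul_iff₀ hn0]
  rw [lt_div_iff₀ hn0] at h3
  linarith

end

/-! ### The exponent of a mixture -/

section

variable {X Y : Type*} [Fintype X] [Countable Y]

/-- The half-open intervals between consecutive partial sums of a probability vector partition
`[0, 1)`. -/
lemma existsUnique_mem_Ico_partialSum {m : ℕ} {α : Fin m → ℝ} (hpos : ∀ i, 0 < α i)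
    (hsum : ∑ i, α i = 1) {ε : ℝ} (h0 : 0 ≤ ε) (h1 : ε < 1) :
    ∃! i : Fin m, ε ∈ Set.Ico (∑ j ∈ Finset.Iio i, α j) (∑ j ∈ Finset.Iic i, α j) := by
  have hm : 0 < m := by
    rcases Nat.eq_zero_or_pos m with rfl | h
    · simp at hsum
    · exact h
  have hlt : ∀ {i j : Fin m}, i < j →
      ε ∈ Set.Ico (∑ j ∈ Finset.Iio i, α j) (∑ j ∈ Finset.Iic i, α j) →
      ¬ ε ∈ Set.Ico (∑ k ∈ Finset.Iio j, α k) (∑ k ∈ Finset.Iic j, α k) := by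
    intro i j hij hi hj
    have : ∑ k ∈ Finset.Iic i, α k ≤ ∑ k ∈ Finset.Iio j, α k :=
      Finset.sum_le_sum_of_subset_of_nonneg
        (fun k hk => Finset.mem_Iio.2 ((Finset.mem_Iic.1 hk).trans_lt hij))
        fun k _ _ => (hpos k).le
    exact absurd (this.trans hj.1) (not_le.2 hi.2)
  let s : Finset (Fin m) := Finset.univ.filter fun i => ε < ∑ j ∈ Finset.Iic i, α j
  have hs : s.Nonempty := by
    refine ⟨⟨m - 1, by omega⟩, Finset.mem_filter.2 ⟨Finset.mem_univ _, ?_⟩⟩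
    have : Finset.Iic (⟨m - 1, by omega⟩ : Fin m) = Finset.univ :=
      Finset.eq_univ_of_forall fun k =>
        Finset.mem_Iic.2 (Fin.le_def.2 (Nat.le_sub_one_of_lt k.isLt))
    rw [this, hsum]
    exact h1
  have hmem : ε ∈ Set.Ico (∑ j ∈ Finset.Iio (s.min' hs), α j)
      (∑ j ∈ Finset.Iic (s.min' hs), α j) := by
    refine ⟨?_, (Finset.mem_filter.1 (s.min'_mem hs)).2⟩
    by_contra! hlow
    have hne : (Finset.Iio (s.min' hs)).Nonempty := by
      by_contra hempty
      rw [Finset.not_nonempty_iff_eq_empty.1 hempty, Finset.sum_empty] at hlow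
      exact absurd h0 (not_le.2 hlow)
    set k := (Finset.Iio (s.min' hs)).max' hne with hk
    have hkmem : k < s.min' hs := Finset.mem_Iio.1 (Finset.max'_mem _ hne)
    have hIic : Finset.Iic k = Finset.Iio (s.min' hs) := by
      ext l
      rw [Finset.mem_Iic, Finset.mem_Iio]
      exact ⟨fun h => h.trans_lt hkmem, fun h => Finset.le_max' _ _ (Finset.mem_Iio.2 h)⟩
    refine absurd (s.min'_le k (Finset.mem_filter.2 ⟨Finset.mem_univ _, ?_⟩)) (not_le.2 hkmem)
    rwa [hIic]
  refine ⟨s.min' hs, hmem, fun i hi => ?_⟩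
  rcases lt_trichotomy i (s.min' hs) with h | h | h
  · exact absurd hmem (hlt h hi)
  · exact h
  · exact absurd hi (hlt h hmem)

lemma IsMixture.guessExponent_eq {m : ℕ} {P : Fin m → PMF (X × Y)} {α : Fin m → ℝ}
    {S : Source X Y} (hS : IsMixture S P α)
    (hP : ∀ i j : Fin m, i < j → condEntropy (P j) < condEntropy (P i)) {ρ ε : ℝ} (hρ : 0 < ρ)
    {i : Fin m} (hε : ε ∈ Set.Ico (∑ j ∈ Finset.Iio i, α j) (∑ j ∈ Finset.Iic i, α j)) :
    guessExponent S ρ ε = ((ρ * condEntropy (P i) : ℝ) : EReal) := by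
  have hanti : ∀ {j k : Fin m}, j ≤ k → condEntropy (P k) ≤ condEntropy (P j) := fun {j k} h =>
    h.eq_or_lt.elim (fun h => h ▸ le_rfl) fun h => (hP j k h).le
  refine le_antisymm ?_ (le_iInf₂ fun E hE => EReal.coe_le_coe_iff.2
    (hS.le_of_isAchievable hρ (fun j hj => hanti hj) hε.2 hE))
  have hle : ∀ δ : ℝ, 0 < δ →
      guessExponent S ρ ε ≤ ((ρ * (condEntropy (P i) + 2 * δ) : ℝ) : EReal) := fun δ hδ =>
    iInf₂_le _ (hS.isAchievable hρ hδ (fun j hj => hanti hj) hε.1)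
  refine EReal.le_of_forall_lt_iff_le.1 fun z hz => ?_
  have hz' := EReal.coe_lt_coe_iff.1 hz
  refine (hle ((z - ρ * condEntropy (P i)) / (2 * ρ))
    (div_pos (sub_pos.2 hz') (by positivity))).trans (EReal.coe_le_coe_iff.2 (le_of_eq ?_))
  field_simp
  ring

lemma IsIID.guessExponent_eq {P : PMF (X × Y)} {S : Source X Y} (hS : IsIID S P) {ρ : ℝ}
    (hρ : 0 < ρ) : guessExponent S ρ 0 = ((ρ * condEntropy P : ℝ) : EReal) := by
  have hmix : IsMixture S (fun _ : Fin 1 => P) fun _ => 1 :=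
    ⟨by simp, fun _ => one_pos, fun n hn x y => by simp [hS n hn x y]⟩
  refine hmix.guessExponent_eq (i := 0)
    (fun i j hij => absurd hij (by simp [Subsingleton.elim i j])) hρ ⟨?_, ?_⟩
  · simp [Finset.sum_eq_zero]
  · exact Finset.sum_pos (fun _ _ => one_pos) ⟨0, Finset.mem_Iic.2 le_rfl⟩

end

/-! ### Comparison with the conditional Rényi entropy -/

/-- For the binary law `(1/3, 2/3)`, the Shannon entropy is smaller than the Rényi entropy of order
`1 / (1 + ρ)`, by strict concavity of the logarithm. -/
lemma binary_entropy_lt_renyi {ρ : ℝ} (hρ : 0 < ρ) :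
    ρ * (1 / 3 * Real.log (1 / (1 / 3)) + 2 / 3 * Real.log (1 / (2 / 3))) <
      (1 + ρ) * Real.log ((1 / 3 : ℝ) ^ (1 / (1 + ρ)) + (2 / 3 : ℝ) ^ (1 / (1 + ρ))) := by
  have h1ρ : 0 < 1 + ρ := by linarith
  set b := ρ / (1 + ρ) with hb
  have hb0 : 0 < b := by positivity
  have hexp : 1 / (1 + ρ) = 1 - b := by rw [hb]; field_simp; ring
  have hpow : ∀ p : ℝ, 0 < p → p ^ (1 / (1 + ρ)) = p * (1 / p) ^ b := by
    intro p hp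
    rw [hexp, Real.rpow_sub hp, Real.rpow_one, one_div, Real.inv_rpow hp.le, div_eq_mul_inv]
  -- `∑ p ^ (1 / (1 + ρ))` is the mean of `(1 / p) ^ b` under `p`.
  have hne : (1 / (1 / 3) : ℝ) ^ b ≠ (1 / (2 / 3) : ℝ) ^ b :=
    (Real.rpow_lt_rpow (by norm_num) (by norm_num) hb0).ne'
  have hlog := strictConcaveOn_log_Ioi.2
    (Set.mem_Ioi.2 (Real.rpow_pos_of_pos (by norm_num : (0 : ℝ) < 1 / (1 / 3)) b))
    (Set.mem_Ioi.2 (Real.rpow_pos_of_pos (by norm_num : (0 : ℝ) < 1 / (2 / 3)) b)) hne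
    (by norm_num : (0 : ℝ) < 1 / 3) (by norm_num : (0 : ℝ) < 2 / 3) (by norm_num)
  simp only [smul_eq_mul] at hlog
  rw [Real.log_rpow (by norm_num), Real.log_rpow (by norm_num)] at hlog
  rw [hpow _ (by norm_num), hpow _ (by norm_num)]
  have h := mul_lt_mul_of_pos_left hlog h1ρ
  have hρb : (1 + ρ) * b = ρ := by rw [hb]; field_simp
  refine lt_of_eq_of_lt ?_ h
  linear_combination (-(1 / 3 * Real.log (1 / (1 / 3)) + 2 / 3 * Real.log (1 / (2 / 3)))) * hρb

lemma exists_condEntropy_lt_condRenyiEntropy {X Y : Type*} [Fintype X]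
    (hX : 2 ≤ Fintype.card X) (hY : Nonempty Y) {ρ : ℝ} (hρ : 0 < ρ) :
    ∃ P : PMF (X × Y), condEntropy P < condRenyiEntropy (1 / (1 + ρ)) P := by
  classical
  obtain ⟨x₀, x₁, hne⟩ := Fintype.exists_pair_of_one_lt_card (α := X) hX
  obtain ⟨y₀⟩ := hY
  have h1ρ : 0 < 1 + ρ := by linarith
  -- The law on `{x₀, x₁} × {y₀}` with weights `1/3` and `2/3`.
  let w : X × Y → ENNReal := fun z =>
    if z = (x₀, y₀) then ENNReal.ofReal (1 / 3) else
      if z = (x₁, y₀) then ENNReal.ofReal (2 / 3) else 0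
  have hw : ∑ z ∈ ({(x₀, y₀), (x₁, y₀)} : Finset (X × Y)), w z = 1 := by
    rw [Finset.sum_pair (by simp [hne])]
    simp only [w, if_true, Prod.mk.injEq, hne.symm, false_and, if_false]
    rw [← ENNReal.ofReal_add (by norm_num) (by norm_num)]
    norm_num
  let P : PMF (X × Y) := PMF.ofFinset w {(x₀, y₀), (x₁, y₀)} hw fun z hz => by
    simp only [Finset.mem_insert, Finset.mem_singleton, not_or] at hz
    simp [w, hz.1, hz.2]
  have hP : ∀ x y, prob P x y = if y = y₀ then
      (if x = x₀ then 1 / 3 else if x = x₁ then 2 / 3 else 0) else 0 := by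
    intro x y
    change (w (x, y)).toReal = _
    by_cases hy : y = y₀
    · by_cases h0 : x = x₀
      · simp [w, hy, h0]
      · by_cases h1 : x = x₁
        · simp [w, hy, h1, hne.symm, ENNReal.toReal_ofReal (by norm_num : (0 : ℝ) ≤ 2 / 3)]
        · simp [w, hy, h0, h1]
    · simp [w, hy]
  have hsum : ∀ g : ℝ → ℝ, g 0 = 0 → ∑ x, g (prob P x y₀) = g (1 / 3) + g (2 / 3) := by
    intro g hg
    rw [Fintype.sum_eq_add x₀ x₁ hne fun x hx => by rw [hP]; simp [hx.1, hx.2, hg]]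
    rw [hP, hP]
    simp [hne.symm]
  have hmarg : margY P y₀ = 1 := by
    rw [margY, hsum (fun p => p) rfl]
    norm_num
  refine ⟨P, ?_⟩
  have hH : condEntropy P = 1 / 3 * Real.log (1 / (1 / 3)) + 2 / 3 * Real.log (1 / (2 / 3)) := by
    rw [condEntropy, tsum_eq_single y₀ fun y hy => by simp [hP, hy]]
    simp only [hmarg, div_one]
    exact hsum (fun p => p * Real.log (1 / p)) (by simp)
  have hR : condRenyiEntropy (1 / (1 + ρ)) P = 1 / ρ * ((1 + ρ) *
      Real.log ((1 / 3 : ℝ) ^ (1 / (1 + ρ)) + (2 / 3 : ℝ) ^ (1 / (1 + ρ)))) := by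
    have ha : 1 / (1 + ρ) ≠ 0 := by positivity
    have hzero : (0 : ℝ) ^ (1 / (1 + ρ)) = 0 := Real.zero_rpow ha
    rw [condRenyiEntropy, tsum_eq_single y₀ fun y hy => by
      simp only [hP, hy, if_false, hzero, Finset.sum_const_zero]
      exact Real.zero_rpow (one_div_ne_zero ha)]
    rw [hsum (fun p => p ^ (1 / (1 + ρ))) hzero, Real.log_rpow (by positivity), one_div_one_div]
    congr 1
    have := hρ.ne'
    field_simp
    rw [add_sub_cancel_left]
    exact div_self this
  rw [hH, hR, one_div ρ, lt_inv_mul_iff₀ hρ]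
  exact binary_entropy_lt_renyi hρ

end Guessing

end

theorem corollary2 {X Y : Type*} [Fintype X] [Countable Y] (ρ : ℝ) (hρ : 0 < ρ) :
    (∀ (m : ℕ) (P : Fin m → PMF (X × Y)) (α : Fin m → ℝ) (S : Guessing.Source X Y),
      Guessing.IsMixture S P α →
      (∀ i j : Fin m, i < j → Guessing.condEntropy (P j) < Guessing.condEntropy (P i)) →
      ∀ ε : ℝ, 0 ≤ ε → ε < 1 →
        (∃! i : Fin m,
          ε ∈ Set.Ico (∑ j ∈ Finset.Iio i, α j) (∑ j ∈ Finset.Iic i, α j)) ∧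
        ∀ i : Fin m, ε ∈ Set.Ico (∑ j ∈ Finset.Iio i, α j) (∑ j ∈ Finset.Iic i, α j) →
          Guessing.guessExponent S ρ ε = ((ρ * Guessing.condEntropy (P i) : ℝ) : EReal)) ∧
    (∀ (P : PMF (X × Y)) (S : Guessing.Source X Y), Guessing.IsIID S P →
      Guessing.guessExponent S ρ 0 = ((ρ * Guessing.condEntropy P : ℝ) : EReal)) ∧
    (2 ≤ Fintype.card X → Nonempty Y →
      ∃ (P : PMF (X × Y)) (S : Guessing.Source X Y), Guessing.IsIID S P ∧
        Guessing.guessExponent S ρ 0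
          < ((ρ * Guessing.condRenyiEntropy (1 / (1 + ρ)) P : ℝ) : EReal)) := by
  refine ⟨fun m P α S hS hP ε h0 h1 =>
    ⟨Guessing.existsUnique_mem_Ico_partialSum hS.pos hS.sum_eq_one h0 h1,
      fun i hi => hS.guessExponent_eq hP hρ hi⟩, fun P S hS => hS.guessExponent_eq hρ,
    fun hX hY => ?_⟩
  obtain ⟨P, hP⟩ := Guessing.exists_condEntropy_lt_condRenyiEntropy (X := X) hX hY hρ
  refine ⟨P, Guessing.iidSource P, Guessing.isIID_iidSource P, ?_⟩
  rw [(Guessing.isIID_iidSource P).guessExponent_eq hρ]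
  exact EReal.coe_lt_coe_iff.2 (mul_lt_mul_of_pos_left hP hρ)
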